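/- Let $\mathcal L\subset\mathbb R^m$ be a linear subspace of dimension $d$ that contains a vector with all coordinates strictly positive. Identify $\mathbb R^m$ with the space of diagonal matrices inside the space $\mathbb S^m$ of real symmetric $m\times m$ matrices, so that $\mathcal L$ defines a diagonal linear concentration model. The ML degree of a linear concentration model given by a linear subspace $\mathcal L\subset\mathbb S^m$ is the number of complex symmetric matrices $\Sigma$ that satisfy the likelihood equations $$\Sigma K=\mathrm{Id}_m,\qquad K\in\mathcal L_{\mathbb C},\qquad \operatorname{trace}\bigl((\Sigma-S)B\bigr)=0\ \text{ for all } B\in\mathcal L,$$ for a generic matrix $S\in\mathbb S^m$, that is, for all $S\in\mathbb S^m$ outside some proper algebraic subset of $\mathbb S^m$. Here $\mathcal L_{\mathbb C}$ is the complexification of $\mathcal L$. Let $N(\mathcal L)$ be the matroid on $\{1,\dots,m\}$ in which a set $I$ is independent when the coordinate functions $x_i$, $i\in I$, are linearly independent on $\mathcal L^\perp=\{x\in\mathbb R^m:\langle v,x\rangle=0\text{ for all }v\in\mathcal L\}$. Let $\beta(\mathcal L)$ be the number of broken circuit bases of the dual matroid $N(\mathcal L)^*$, that is, of bases of $N(\mathcal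 L)^*$ that contain no set of the form $C\setminus\{\min C\}$ with $C$ a circuit of $N(\mathcal L)^*$. (This is the number of bounded regions of the hyperplane arrangement that the coordinate hyperplanes $\{x_i=0\}$ cut out on a generic translate of $\mathcal L^\perp$; for a uniform matroid with $d\ge 1$ it is $\binom{m-1}{d-1}$.) Then $N(\mathcal L)$ has rank $m-d$, and the ML degree of the diagonal linear concentration model $\mathcal L$ is equal to $\beta(\mathcal L)$. -/

import Mathlib

open scoped Matrix

namespace LinearConcentration

/-- The complexification of a real linear space of `n × n` matrices. -/
def complexify {n : Type*} (L : Submodule ℝ (Matrix n n ℝ)) : Submodule ℂ (Matrix n n ℂ) :=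
  Submodule.span ℂ ((fun K : Matrix n n ℝ => K.map Complex.ofReal) '' (L : Set (Matrix n n ℝ)))

/-- The complex symmetric solutions `Σ` of the likelihood equations
`Σ * K = 1`, `K ∈ L_ℂ`, `Σ - S ∈ (L^⊥)_ℂ`, where `⟨A, B⟩ = trace (A * B)`. -/
def likelihoodSolutions {n : Type*} [Fintype n] [DecidableEq n]
    (L : Submodule ℝ (Matrix n n ℝ)) (S : Matrix n n ℝ) : Set (Matrix n n ℂ) :=
  {Sig | Sig.IsSymm ∧ (∃ K ∈ complexify L, Sig * K = 1) ∧
    ∀ B ∈ L, ((Sig - S.map Complex.ofReal) * B.map Complex.ofReal).trace = 0}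

/-- The linear concentration model of the space `L` of symmetric matrices has ML degree `k`: off a
proper algebraic subset of the space of real symmetric matrices `S`, the likelihood equations have
exactly `k` complex solutions (in particular, finitely many). -/
def HasMLDegree {n : Type*} [Fintype n] [DecidableEq n]
    (L : Submodule ℝ (Matrix n n ℝ)) (k : ℕ) : Prop :=
  ∃ f : MvPolynomial (n × n) ℝ,
    (∃ S : Matrix n n ℝ, S.IsSymm ∧ MvPolynomial.eval (fun p => S p.1 p.2) f ≠ 0) ∧
    ∀ S : Matrix n n ℝ, S.IsSymm → MvPolynomial.eval (fun p => S p.1 p.2) f ≠ 0 →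
      (likelihoodSolutions L S).encard = k

/-- The exchange property of linearly independent subfamilies of a finite family of vectors. -/
theorem exists_insert_linearIndepOn {ι W : Type*} [Finite ι] [AddCommGroup W] [Module ℝ W]
    (v : ι → W) {I J : Set ι} (hI : LinearIndepOn ℝ v I) (hJ : LinearIndepOn ℝ v J)
    (hIJ : I.ncard < J.ncard) : ∃ e ∈ J, e ∉ I ∧ LinearIndepOn ℝ v (insert e I) := by
  classical
  by_contra! h
  have hsub : v '' J ⊆ Submodule.span ℝ (v '' I) := by
    rintro _ ⟨e, he, rfl⟩
    by_cases heI : e ∈ I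
    · exact Submodule.subset_span ⟨e, heI, rfl⟩
    · by_contra hc
      exact h e he heI ((linearIndepOn_insert heI).2 ⟨hI, hc⟩)
  have hle : Submodule.span ℝ (v '' J) ≤ Submodule.span ℝ (v '' I) := Submodule.span_le.2 hsub
  have key : ∀ {T : Set ι}, LinearIndepOn ℝ v T →
      Module.finrank ℝ (Submodule.span ℝ (v '' T)) = T.ncard := by
    intro T hT
    have := Fintype.ofFinite T
    have h1 := finrank_span_eq_card (R := ℝ) (b := fun i : T => v i) hT
    rw [Set.image_eq_range, h1, ← Nat.card_eq_fintype_card, Nat.card_coe_set_eq]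
  have : FiniteDimensional ℝ (Submodule.span ℝ (v '' I)) :=
    FiniteDimensional.span_of_finite ℝ (Set.toFinite _)
  have := Submodule.finrank_mono hle
  rw [key hI, key hJ] at this
  omega

/-- The linear matroid of a finite family of vectors: a set of indices is independent when the
corresponding subfamily is linearly independent. -/
def vectorMatroid {ι W : Type*} [Finite ι] [AddCommGroup W] [Module ℝ W] (v : ι → W) : Matroid ι :=
  (IndepMatroid.ofFinite (E := Set.univ) Set.finite_univ (fun I => LinearIndepOn ℝ v I)
    (linearIndepOn_empty ℝ v)
    (fun _ _ hJ hIJ => hJ.mono hIJ)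
    (fun _ _ hI hJ hIJ => exists_insert_linearIndepOn v hI hJ hIJ)
    (fun _ _ => Set.subset_univ _)).matroid

/-- The orthogonal complement of `L` for the standard inner product of `ℝ^m`. -/
def perp {m : ℕ} (L : Submodule ℝ (Fin m → ℝ)) : Submodule ℝ (Fin m → ℝ) where
  carrier := {x | ∀ v ∈ L, v ⬝ᵥ x = 0}
  zero_mem' := fun v _ => dotProduct_zero v
  add_mem' := fun {x y} hx hy v hv => by rw [dotProduct_add, hx v hv, hy v hv, add_zero]
  smul_mem' := fun c x hx v hv => by rw [dotProduct_smul, hx v hv, smul_zero]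

/-- The matroid of rank `m - d` on `{1, …, m}` of a `d`-dimensional subspace `L` of `ℝ^m`: the
linear matroid of the `m` coordinate functions on `L^⊥`, that is, of the arrangement cut out on
`L^⊥` by the coordinate hyperplanes. Its dual is the rank `d` matroid of the columns of any matrix
with row space `L`. -/
noncomputable def perpMatroid {m : ℕ} (L : Submodule ℝ (Fin m → ℝ)) : Matroid (Fin m) :=
  vectorMatroid (fun i : Fin m =>
    (LinearMap.proj i : (Fin m → ℝ) →ₗ[ℝ] ℝ) ∘ₗ (perp L).subtype)

/-- A broken circuit is a circuit with its smallest element removed. -/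
def IsBrokenCircuit {α : Type*} [LinearOrder α] (M : Matroid α) (X : Set α) : Prop :=
  ∃ C e, M.IsCircuit C ∧ IsLeast C e ∧ X = C \ {e}

/-- The broken circuit bases of a matroid: the bases that contain no broken circuit. -/
def brokenCircuitBases {α : Type*} [LinearOrder α] (M : Matroid α) : Set (Set α) :=
  {B | M.IsBase B ∧ ∀ X, IsBrokenCircuit M X → ¬ X ⊆ B}

/-- The invariant `β(L)`: the number of broken circuit bases of the rank `d` matroid dual to the
rank `m - d` matroid of `L`. It is the number of bounded regions cut out by the
coordinate hyperplanes on a generic translate of `L^⊥`, and it equals `(m-1).choose (d-1)` when the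
matroid is uniform and `1 ≤ d`. -/
noncomputable def beta {m : ℕ} (L : Submodule ℝ (Fin m → ℝ)) : ℕ :=
  (brokenCircuitBases (perpMatroid L)✶).ncard

end LinearConcentration

namespace LinearConcentration

/-! For diagonal `L` the unknown is a vector `k` in the complexification of `L` with nonzero entries
and `1/k - s` orthogonal to `L`, where `s` is the diagonal of `S`. Pairing with the imaginary part
`q` of `k`, which lies in `L`, gives `∑ qᵢ²/|kᵢ|² = 0`, so every solution is real
(`likelihoodSolutions_diagonal`).

Real solutions are sorted by sign vector `e`. Write `u` for the functional `∑ sᵢ xᵢ` on `L`. The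
points `x ≥ 0` with `∑ xᵢ eᵢ (coordFun L i) = u` form the closure of one region of `s + L^⊥`. It is
nonempty and bounded when `u` lies in the cone of the signed coordinate functions and that cone is
pointed. Then, for generic `s`, the maximum of `∏ xᵢ` gives the unique solution with signs `e`
(`bijOn_realSolutions`).

Such `e` are counted by deletion-contraction: they satisfy the same recursion as the sets without
broken circuit whose span contains `u` (`sum_inPointedCone_eq_sum_noBrokenCircuit`). For generic `s`
only spanning sets have `u` in their span, so the count is that of broken circuit bases of the
matroid of coordinate functions on `L`, which is the dual matroid (`perpMatroid_dual`). -/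

/-! ### Pointed cones under deletion and contraction -/

/-- `u` is a nonnegative combination of the vectors `w i`, which admit no nontrivial nonnegative
relation. -/
def InPointedCone {n : ℕ} {V : Type*} [AddCommGroup V] [Module ℝ V] (w : Fin n → V) (u : V) :
    Prop :=
  (∃ x : Fin n → ℝ, (∀ i, 0 ≤ x i) ∧ ∑ i, x i • w i = u) ∧
    ∀ y : Fin n → ℝ, (∀ i, 0 ≤ y i) → ∑ i, y i • w i = 0 → y = 0

theorem inPointedCone_snoc {n : ℕ} {V : Type*} [AddCommGroup V] [Module ℝ V] (w : Fin n → V)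
    (t u : V) :
    InPointedCone (Fin.snoc w t : Fin (n + 1) → V) u ↔
      (∃ x : Fin n → ℝ, ∃ a : ℝ, (∀ i, 0 ≤ x i) ∧ 0 ≤ a ∧ ∑ i, x i • w i + a • t = u) ∧
      ∀ (y : Fin n → ℝ) (b : ℝ), (∀ i, 0 ≤ y i) → 0 ≤ b → ∑ i, y i • w i + b • t = 0 →
        y = 0 ∧ b = 0 := by
  simp only [InPointedCone, Fin.sum_univ_castSucc, Fin.snoc_castSucc, Fin.snoc_last]
  constructor
  · rintro ⟨⟨x, hx, hu⟩, h⟩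
    refine ⟨⟨fun i => x i.castSucc, x (Fin.last n), fun i => hx _, hx _, hu⟩, ?_⟩
    intro y b hy hb hyb
    have := h (Fin.snoc y b) (fun i => by
      refine Fin.lastCases ?_ (fun j => ?_) i <;> simp [hb, hy]) (by simpa using hyb)
    refine ⟨funext fun i => ?_, ?_⟩
    · simpa using congrFun this i.castSucc
    · simpa using congrFun this (Fin.last n)
  · rintro ⟨⟨x, a, hx, ha, hu⟩, h⟩
    refine ⟨⟨Fin.snoc x a, fun i => ?_, by simpa using hu⟩, ?_⟩
    · refine Fin.lastCases ?_ (fun j => ?_) i <;> simp [ha, hx]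
    · intro y hy hy0
      obtain ⟨h1, h2⟩ := h (fun i => y i.castSucc) (y (Fin.last n)) (fun i => hy _) (hy _) hy0
      funext i
      refine Fin.lastCases ?_ (fun j => ?_) i
      · exact h2
      · exact congrFun h1 j

/-- Working modulo `t` amounts to letting the coefficient of `t` take either sign. -/
theorem inPointedCone_mkQ {n : ℕ} {V : Type*} [AddCommGroup V] [Module ℝ V] (w : Fin n → V)
    (t u : V) :
    InPointedCone (fun i => (Submodule.span ℝ {t}).mkQ (w i)) ((Submodule.span ℝ {t}).mkQ u) ↔
      (∃ x : Fin n → ℝ, ∃ a : ℝ, (∀ i, 0 ≤ x i) ∧ ∑ i, x i • w i + a • t = u) ∧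
      ∀ (y : Fin n → ℝ) (b : ℝ), (∀ i, 0 ≤ y i) → ∑ i, y i • w i + b • t = 0 → y = 0 := by
  have key : ∀ (x : Fin n → ℝ) (z : V),
      (∑ i, x i • (Submodule.span ℝ {t}).mkQ (w i) = (Submodule.span ℝ {t}).mkQ z ↔
        ∃ a : ℝ, ∑ i, x i • w i + a • t = z) := by
    intro x z
    simp only [← map_smul, ← map_sum]
    rw [eq_comm, Submodule.mkQ_apply, Submodule.mkQ_apply, Submodule.Quotient.eq,
      Submodule.mem_span_singleton]
    exact exists_congr fun a => by rw [eq_sub_iff_add_eq, add_comm]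
  have key0 := fun x => key x 0
  rw [map_zero] at key0
  simp only [InPointedCone, key, key0]
  constructor
  · rintro ⟨⟨x, hx, a, h⟩, h'⟩
    exact ⟨⟨x, a, hx, h⟩, fun y b hy hyb => h' y hy ⟨b, hyb⟩⟩
  · rintro ⟨⟨x, a, hx, h⟩, h'⟩
    exact ⟨⟨x, hx, a, h⟩, fun y hy ⟨b, hyb⟩ => h' y b hy hyb⟩

theorem comb_nonneg {n : ℕ} {V : Type*} [AddCommGroup V] [Module ℝ V] (w : Fin n → V)
    {x y : Fin n → ℝ} (p q : ℝ) :
    ∑ i, (p * x i + q * y i) • w i = p • ∑ i, x i • w i + q • ∑ i, y i • w i := by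
  simp only [add_smul, mul_smul, Finset.sum_add_distrib, Finset.smul_sum]

open Classical in
/-- Deletion and contraction of the last vector for pointed cones. -/
theorem inPointedCone_deletion_contraction {n : ℕ} {V : Type*} [AddCommGroup V] [Module ℝ V]
    (w : Fin n → V) {t : V} (ht : t ≠ 0) (u : V) :
    (if InPointedCone (Fin.snoc w t : Fin (n + 1) → V) u then 1 else 0) +
      (if InPointedCone (Fin.snoc w (-t) : Fin (n + 1) → V) u then 1 else 0) =
    (if InPointedCone w u then 1 else 0) +
      (if InPointedCone (fun i => (Submodule.span ℝ {t}).mkQ (w i))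
        ((Submodule.span ℝ {t}).mkQ u) then 1 else 0 : ℕ) := by
  rw [inPointedCone_snoc, inPointedCone_snoc, inPointedCone_mkQ]
  set c : (Fin n → ℝ) → V := fun x => ∑ i, x i • w i with hc
  have hcomb : ∀ (x y : Fin n → ℝ) (p q : ℝ),
      c (fun i => p * x i + q * y i) = p • c x + q • c y := fun x y p q => comb_nonneg w p q
  have hnn : ∀ {x y : Fin n → ℝ} {p q : ℝ}, (∀ i, 0 ≤ x i) → (∀ i, 0 ≤ y i) → 0 ≤ p → 0 ≤ q →
      ∀ i, 0 ≤ p * x i + q * y i := fun hx hy hp hq i =>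
    add_nonneg (mul_nonneg hp (hx i)) (mul_nonneg hq (hy i))
  have hc0 : c 0 = 0 := by simp [hc]
  set Ap : Prop := ∀ (y : Fin n → ℝ) (b : ℝ), (∀ i, 0 ≤ y i) → 0 ≤ b → c y + b • t = 0 →
        y = 0 ∧ b = 0 with hAp
  set Am : Prop := ∀ (y : Fin n → ℝ) (b : ℝ), (∀ i, 0 ≤ y i) → 0 ≤ b → c y + b • (-t) = 0 →
        y = 0 ∧ b = 0 with hAm
  set Aq : Prop := ∀ (y : Fin n → ℝ) (b : ℝ), (∀ i, 0 ≤ y i) → c y + b • t = 0 → y = 0 with hAq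
  set A0 : Prop := ∀ y : Fin n → ℝ, (∀ i, 0 ≤ y i) → c y = 0 → y = 0 with hA0
  set Cp : Prop := ∃ x : Fin n → ℝ, ∃ a : ℝ, (∀ i, 0 ≤ x i) ∧ 0 ≤ a ∧ c x + a • t = u with hCp
  set Cm : Prop := ∃ x : Fin n → ℝ, ∃ a : ℝ, (∀ i, 0 ≤ x i) ∧ 0 ≤ a ∧ c x + a • (-t) = u with hCm
  set Cq : Prop := ∃ x : Fin n → ℝ, ∃ a : ℝ, (∀ i, 0 ≤ x i) ∧ c x + a • t = u with hCq
  set C0 : Prop := ∃ x : Fin n → ℝ, (∀ i, 0 ≤ x i) ∧ c x = u with hC0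
  have hI : InPointedCone w u ↔ C0 ∧ A0 := Iff.rfl
  rw [hI]
  -- A relation modulo `t` is a relation involving `t` or `-t`, according to the sign of `b`; `t ≠
  -- 0` rules out relations with `y = 0` and `b ≠ 0`.
  have hq : Aq ↔ Ap ∧ Am := by
    constructor
    · intro h
      refine ⟨fun y b hy hb e => ?_, fun y b hy hb e => ?_⟩
      · have := h y b hy e
        subst this
        simpa [hc0, ht] using e
      · have := h y (-b) hy (by simpa using e)
        subst this
        simpa [hc0, ht] using e
    · rintro ⟨h1, h2⟩ y b hy e
      rcases le_total 0 b with hb | hb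
      · exact (h1 y b hy hb e).1
      · exact (h2 y (-b) hy (by linarith) (by simpa using e)).1
  have hp0 : Ap → A0 := fun h y hy e => (h y 0 hy le_rfl (by simpa using e)).1
  have hm0 : Am → A0 := fun h y hy e => (h y 0 hy le_rfl (by simpa using e)).1
  -- a failure of acyclicity on one side puts `t` or `-t` into the cone
  have hnp : A0 → ¬ Ap → ∃ y : Fin n → ℝ, (∀ i, 0 ≤ y i) ∧ c y = -t := by
    intro h0 h
    rw [hAp] at h
    push Not at h
    obtain ⟨y, b, hy, hb, e, hne⟩ := h
    rcases hb.eq_or_lt with rfl | hb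
    · exact absurd rfl (hne (h0 y hy (by simpa using e)))
    -- The relation divided by `b`; the zero summand only fits it to `hcomb`.
    · refine ⟨fun i => b⁻¹ * y i + 0 * y i, hnn hy hy (inv_nonneg.2 hb.le) le_rfl, ?_⟩
      rw [hcomb, eq_neg_of_add_eq_zero_left e, zero_smul, add_zero, smul_neg, smul_smul,
        inv_mul_cancel₀ hb.ne', one_smul]
  have hnm : A0 → ¬ Am → ∃ y : Fin n → ℝ, (∀ i, 0 ≤ y i) ∧ c y = t := by
    intro h0 h
    rw [hAm] at h
    push Not at h
    obtain ⟨y, b, hy, hb, e, hne⟩ := h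
    rcases hb.eq_or_lt with rfl | hb
    · exact absurd rfl (hne (h0 y hy (by simpa using e)))
    · refine ⟨fun i => b⁻¹ * y i + 0 * y i, hnn hy hy (inv_nonneg.2 hb.le) le_rfl, ?_⟩
      rw [hcomb, eq_neg_of_add_eq_zero_left e, zero_smul, add_zero, smul_neg b, neg_neg,
        smul_smul, inv_mul_cancel₀ hb.ne', one_smul]
  have hpm : A0 → Ap ∨ Am := by
    intro h0
    by_contra! h
    obtain ⟨y, hy, e⟩ := hnp h0 h.1
    obtain ⟨z, hz, f⟩ := hnm h0 h.2
    have := h0 (fun i => 1 * y i + 1 * z i) (hnn hy hz zero_le_one zero_le_one)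
      (by rw [hcomb, e, f]; simp)
    have hy0 : y = 0 := by
      funext i
      have h1 := congrFun this i
      have h2 := hy i
      have h3 := hz i
      simp only [Pi.zero_apply] at h1 ⊢
      linarith
    rw [hy0, hc0] at e
    exact ht (by simpa using e.symm)
  have hC0p : C0 → Cp := fun ⟨x, hx, e⟩ => ⟨x, 0, hx, le_rfl, by simpa using e⟩
  have hC0m : C0 → Cm := fun ⟨x, hx, e⟩ => ⟨x, 0, hx, le_rfl, by simpa using e⟩
  have hCqpm : Cq ↔ Cp ∨ Cm := by
    constructor
    · rintro ⟨x, a, hx, e⟩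
      rcases le_total 0 a with ha | ha
      · exact Or.inl ⟨x, a, hx, ha, e⟩
      · exact Or.inr ⟨x, -a, hx, by linarith, by simpa using e⟩
    · rintro (⟨x, a, hx, _, e⟩ | ⟨x, a, hx, _, e⟩)
      · exact ⟨x, a, hx, e⟩
      · exact ⟨x, -a, hx, by simpa using e⟩
  have hCpm : Cp → Cm → C0 := by
    rintro ⟨x, a, hx, ha, e⟩ ⟨y, b, hy, hb, f⟩
    rcases ha.eq_or_lt with rfl | ha
    · exact ⟨x, hx, by simpa using e⟩
    · have hab : 0 < a + b := by linarith
      -- The convex weights for which the two multiples of `t` cancel.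
      refine ⟨fun i => (b / (a + b)) * x i + (a / (a + b)) * y i,
        hnn hx hy (by positivity) (by positivity), ?_⟩
      rw [hcomb, eq_sub_of_add_eq e, eq_sub_of_add_eq f]
      have h1 : b / (a + b) + a / (a + b) = 1 := by field_simp; ring
      calc _ = (b / (a + b) + a / (a + b)) • u + (a / (a + b) * b - b / (a + b) * a) • t := by
              module
        _ = u := by
          rw [h1, show a / (a + b) * b - b / (a + b) * a = 0 by ring]
          simp
  -- If adding `-t` destroys pointedness, `t` is already in the cone, so adding `t` does not enlarge
  -- it.
  have hCpt : A0 → ¬ Am → Cp → C0 := by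
    rintro h0 hm ⟨x, a, hx, ha, e⟩
    obtain ⟨y, hy, f⟩ := hnm h0 hm
    exact ⟨fun i => 1 * x i + a * y i, hnn hx hy zero_le_one ha, by rw [hcomb, f, one_smul, e]⟩
  have hCmt : A0 → ¬ Ap → Cm → C0 := by
    rintro h0 hm ⟨x, a, hx, ha, e⟩
    obtain ⟨y, hy, f⟩ := hnp h0 hm
    exact ⟨fun i => 1 * x i + a * y i, hnn hx hy zero_le_one ha, by rw [hcomb, f, one_smul, e]⟩
  -- What remains is inclusion-exclusion on opaque propositions, settled by a truth table.
  clear_value Ap Am Aq A0 Cp Cm Cq C0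
  rw [hq, hCqpm]
  clear hAp hAm hAq hA0 hCp hCm hCq hC0 hnp hnm hI hq hCqpm hcomb hnn hc hc0
  by_cases h1 : Ap <;> by_cases h2 : Am <;> by_cases h3 : A0 <;> by_cases h4 : Cp <;>
    by_cases h5 : Cm <;> by_cases h6 : C0 <;> simp_all

/-! ### Sets without broken circuits and the common recursion -/

/-- The sign `1` or `-1` coded by a Boolean. -/
def boolSign (b : Bool) : ℝ := cond b 1 (-1)

/-- `b` codes a set of indices that contains no broken circuit of the vectors `v i`. -/
def NoBrokenCircuit {n : ℕ} {V : Type*} [AddCommGroup V] [Module ℝ V] (v : Fin n → V)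
    (b : Fin n → Bool) : Prop :=
  ∀ i, v i ∉ Submodule.span ℝ (v '' {j | i < j ∧ b j = true})

theorem image_snoc_false {n : ℕ} {V : Type*} (v : Fin (n + 1) → V) (b : Fin n → Bool)
    (p : Fin (n + 1) → Prop) :
    v '' {j | p j ∧ (Fin.snoc b false : Fin (n + 1) → Bool) j = true} =
      (fun i => v i.castSucc) '' {j | p j.castSucc ∧ b j = true} := by
  ext x
  simp [Fin.exists_fin_succ', and_assoc]

theorem image_snoc_true {n : ℕ} {V : Type*} (v : Fin (n + 1) → V) (b : Fin n → Bool)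
    (p : Fin (n + 1) → Prop) (hp : p (Fin.last n)) :
    v '' {j | p j ∧ (Fin.snoc b true : Fin (n + 1) → Bool) j = true} =
      (fun i => v i.castSucc) '' {j | p j.castSucc ∧ b j = true} ∪ {v (Fin.last n)} := by
  ext x
  simp [Fin.exists_fin_succ', and_assoc, hp, @eq_comm _ x, or_comm]

theorem mkQ_mem_span_image_iff {V : Type*} {ι : Type*} [AddCommGroup V] [Module ℝ V] (t : V)
    (v : ι → V) (s : Set ι) (x : V) :
    (Submodule.span ℝ {t}).mkQ x ∈
        Submodule.span ℝ ((fun i => (Submodule.span ℝ {t}).mkQ (v i)) '' s) ↔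
      x ∈ Submodule.span ℝ (v '' s ∪ {t}) := by
  have : (fun i => (Submodule.span ℝ {t}).mkQ (v i)) '' s =
      (Submodule.span ℝ {t}).mkQ '' (v '' s) := by rw [Set.image_image]
  rw [this, ← Submodule.map_span, ← Submodule.mem_comap, Submodule.comap_map_mkQ,
    Submodule.span_union, sup_comm]

theorem noBrokenCircuit_snoc_false {n : ℕ} {V : Type*} [AddCommGroup V] [Module ℝ V]
    (v : Fin (n + 1) → V) (hv : v (Fin.last n) ≠ 0) (b : Fin n → Bool) :
    NoBrokenCircuit v (Fin.snoc b false) ↔ NoBrokenCircuit (fun i => v i.castSucc) b := by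
  simp only [NoBrokenCircuit, image_snoc_false v b (fun j => _ < j)]
  rw [Fin.forall_fin_succ']
  simp [hv, (Fin.le_last _).not_gt]

/-- The last index exceeds all others, so when selected it enters the span in every other condition
and can be divided out. This is why the recursion removes the last vector. -/
theorem noBrokenCircuit_snoc_true {n : ℕ} {V : Type*} [AddCommGroup V] [Module ℝ V]
    (v : Fin (n + 1) → V) (hv : v (Fin.last n) ≠ 0) (b : Fin n → Bool) :
    NoBrokenCircuit v (Fin.snoc b true) ↔
      NoBrokenCircuit (fun i => (Submodule.span ℝ {v (Fin.last n)}).mkQ (v i.castSucc)) b := by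
  simp only [NoBrokenCircuit]
  rw [Fin.forall_fin_succ']
  have h1 : v (Fin.last n) ∉ Submodule.span ℝ (v '' {j | Fin.last n < j ∧
      (Fin.snoc b true : Fin (n + 1) → Bool) j = true}) := by
    simp [hv, (Fin.le_last _).not_gt]
  rw [and_iff_left h1]
  refine forall_congr' fun i => ?_
  rw [image_snoc_true v b (fun j => i.castSucc < j) (Fin.castSucc_lt_last i),
    mkQ_mem_span_image_iff _ (fun i : Fin n => v i.castSucc)]
  simp only [Fin.castSucc_lt_castSucc_iff]

theorem sum_bool_snoc {n : ℕ} (F : (Fin (n + 1) → Bool) → ℕ) :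
    ∑ e, F e = ∑ e : Fin n → Bool, (F (Fin.snoc e true) + F (Fin.snoc e false)) := by
  rw [← (Fin.snocEquiv (fun _ : Fin (n + 1) => Bool)).sum_comp, Fintype.sum_prod_type,
    Fintype.sum_bool, Finset.sum_add_distrib]
  rfl

open Classical in
/-- The sign vectors whose pointed cone contains `u` are equinumerous with the sets without broken
circuits whose span contains `u`. -/
theorem sum_inPointedCone_eq_sum_noBrokenCircuit {n : ℕ} :
    ∀ {V : Type*} [AddCommGroup V] [Module ℝ V] (v : Fin n → V) (u : V),
    ∑ e : Fin n → Bool, (if InPointedCone (fun i => boolSign (e i) • v i) u then 1 else 0) =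
      ∑ b : Fin n → Bool, (if NoBrokenCircuit v b ∧
        u ∈ Submodule.span ℝ (v '' {j | b j = true}) then 1 else 0 : ℕ) := by
  induction n with
  | zero =>
    intro V _ _ v u
    have h1 : ∀ b : Fin 0 → Bool, {j | b j = true} = ∅ := fun b => Set.eq_empty_of_isEmpty _
    have h2 : ∀ y : Fin 0 → ℝ, y = 0 := fun y => Subsingleton.elim _ _
    simp only [InPointedCone, NoBrokenCircuit, h1, h2, @eq_comm _ _ u, Finset.univ_eq_empty,
      Finset.sum_empty, Set.image_empty, Submodule.span_empty, Submodule.mem_bot, IsEmpty.forall_iff,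
      true_and, implies_true, and_true, exists_const]
  | succ n ih =>
    intro V _ _ v u
    -- A zero vector makes both sides vanish: it lies in every span, and alone gives a nontrivial
    -- nonnegative relation.
    rcases eq_or_ne (v (Fin.last n)) 0 with h0 | h0
    · rw [Finset.sum_eq_zero, Finset.sum_eq_zero]
      · intro b _
        rw [if_neg]
        rintro ⟨h, -⟩
        exact h (Fin.last n) (by rw [h0]; exact zero_mem _)
      · intro e _
        rw [if_neg]
        rintro ⟨-, h⟩
        have := h (Pi.single (Fin.last n) 1) (fun i => by
          by_cases hi : i = Fin.last n
          · subst hi; simp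
          · simp [hi]) (by simp [Pi.single_apply, ite_smul, h0])
        simpa using congrFun this (Fin.last n)
    · rw [sum_bool_snoc, sum_bool_snoc]
      have hs : ∀ (e : Fin n → Bool) (a : Bool),
          (fun i => boolSign ((Fin.snoc e a : Fin (n + 1) → Bool) i) • v i) =
          (Fin.snoc (fun i => boolSign (e i) • v i.castSucc) (boolSign a • v (Fin.last n)) :
            Fin (n + 1) → V) := by
        intro e a
        funext i
        refine Fin.lastCases ?_ (fun j => ?_) i <;> simp
      have hL : ∀ e : Fin n → Bool, _ := fun e => inPointedCone_deletion_contraction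
        (fun i => boolSign (e i) • v i.castSucc) h0 u
      have i1 := ih (fun i => v i.castSucc) u
      have i2 := ih (fun i => (Submodule.span ℝ {v (Fin.last n)}).mkQ (v i.castSucc))
        ((Submodule.span ℝ {v (Fin.last n)}).mkQ u)
      have j1 : boolSign true • v (Fin.last n) = v (Fin.last n) := one_smul _ _
      have j2 : boolSign false • v (Fin.last n) = -v (Fin.last n) := by simp [boolSign]
      simp only [map_smul] at hL
      simp only [hs, j1, j2]
      refine (Finset.sum_congr rfl fun e _ => ?_).trans
        ((Finset.sum_add_distrib.trans (congrArg₂ (· + ·) i1 i2)).trans ?_)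
      · convert hL e using 2
      rw [← Finset.sum_add_distrib]
      refine Finset.sum_congr rfl fun b _ => ?_
      have k1 := image_snoc_true v b (fun _ => True) trivial
      have k2 := image_snoc_false v b (fun _ => True)
      simp only [true_and] at k1 k2
      simp only [noBrokenCircuit_snoc_true v h0, noBrokenCircuit_snoc_false v h0, k1, k2,
          ← mkQ_mem_span_image_iff _ (fun i : Fin n => v i.castSucc)]
      exact add_comm _ _

/-! ### Bases, spanning sets and broken circuits of a linear matroid -/

section VectorMatroid

variable {ι W : Type*} [Finite ι] [AddCommGroup W] [Module ℝ W]

theorem vectorMatroid_indep (v : ι → W) (I : Set ι) :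
    (vectorMatroid v).Indep I ↔ LinearIndepOn ℝ v I := Iff.rfl

theorem vectorMatroid_ground (v : ι → W) : (vectorMatroid v).E = Set.univ := rfl

theorem vectorMatroid_isBase_iff (v : ι → W) (B : Set ι) :
    (vectorMatroid v).IsBase B ↔
      LinearIndepOn ℝ v B ∧ ∀ i, v i ∈ Submodule.span ℝ (v '' B) := by
  rw [Matroid.isBase_iff_maximal_indep]
  constructor
  · intro h
    have hB : LinearIndepOn ℝ v B := h.prop
    refine ⟨hB, fun i => ?_⟩
    by_cases hi : i ∈ B
    · exact Submodule.subset_span ⟨i, hi, rfl⟩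
    · by_contra hc
      exact hi (h.mem_of_prop_insert (x := i)
        ((linearIndepOn_insert (K := ℝ) (f := v) hi).2 ⟨hB, hc⟩))
  · rintro ⟨hB, hs⟩
    refine ⟨hB, fun J hJ hBJ i hi => ?_⟩
    by_contra hc
    have : LinearIndepOn ℝ v (insert i B) :=
      LinearIndepOn.mono ((vectorMatroid_indep v J).1 hJ) (Set.insert_subset hi hBJ)
    exact ((linearIndepOn_insert hc).1 this).2 (hs i)

theorem vectorMatroid_spanning_iff (v : ι → W) (S : Set ι) :
    (vectorMatroid v).Spanning S ↔ ∀ i, v i ∈ Submodule.span ℝ (v '' S) := by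
  rw [Matroid.spanning_iff_exists_isBase_subset (Set.subset_univ _)]
  constructor
  · rintro ⟨B, hB, hBS⟩ i
    exact Submodule.span_mono (Set.image_mono hBS) (((vectorMatroid_isBase_iff v B).1 hB).2 i)
  · intro h
    obtain ⟨B, hBS, -, hs, hB⟩ :=
      exists_linearIndepOn_extension (linearIndepOn_empty ℝ v) (Set.empty_subset S)
    exact ⟨B, (vectorMatroid_isBase_iff v B).2
      ⟨hB, fun i => Submodule.span_le.2 hs (h i)⟩, hBS⟩

theorem mem_span_sdiff_of_isCircuit {v : ι → W} {C : Set ι} (hC : (vectorMatroid v).IsCircuit C)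
    {e : ι} (he : e ∈ C) : v e ∈ Submodule.span ℝ (v '' (C \ {e})) := by
  by_contra h
  refine hC.not_indep ((vectorMatroid_indep v C).2 ?_)
  rw [← Set.insert_sdiff_self_of_mem he]
  exact (linearIndepOn_insert (by simp)).2 ⟨hC.sdiff_singleton_indep he, h⟩

/-- A vector in the span of later members of an independent `B` is the least element of a circuit
whose other elements lie in `B`. Independence need not be required on the right: a circuit inside
`B` would contain its own broken circuit. -/
theorem mem_brokenCircuitBases_vectorMatroid [LinearOrder ι] (v : ι → W) (B : Set ι) :
    B ∈ brokenCircuitBases (vectorMatroid v) ↔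
      (∀ i, v i ∉ Submodule.span ℝ (v '' {j | i < j ∧ j ∈ B})) ∧
        ∀ i, v i ∈ Submodule.span ℝ (v '' B) := by
  have hmin : (∀ i, v i ∉ Submodule.span ℝ (v '' {j | i < j ∧ j ∈ B})) →
      ∀ C e, (vectorMatroid v).IsCircuit C → IsLeast C e → ¬ C \ {e} ⊆ B := by
    intro h C e hC he hCB
    refine h e (Submodule.span_mono (Set.image_mono ?_) (mem_span_sdiff_of_isCircuit hC he.1))
    exact fun j hj => ⟨lt_of_le_of_ne (he.2 hj.1) (Ne.symm hj.2), hCB hj⟩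
  constructor
  · rintro ⟨hB, hbc⟩
    refine ⟨fun i hi => ?_, ((vectorMatroid_isBase_iff v B).1 hB).2⟩
    have hdep : (vectorMatroid v).Dep (insert i {j | i < j ∧ j ∈ B}) := by
      refine ⟨fun h => ?_, Set.subset_univ _⟩
      exact ((linearIndepOn_insert (by simp)).1 ((vectorMatroid_indep v _).1 h)).2 hi
    obtain ⟨C, hCs, hC⟩ := hdep.exists_isCircuit_subset
    have hCB : C \ {i} ⊆ B := fun j hj => ((hCs hj.1).resolve_left hj.2).2
    have hiC : i ∈ C := by
      by_contra hiC
      refine hC.not_indep (hB.indep.subset fun j hj => hCB ⟨hj, ?_⟩)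
      rintro rfl
      exact hiC hj
    refine hbc _ ⟨C, i, hC, ⟨hiC, fun j hj => ?_⟩, rfl⟩ hCB
    rcases hCs hj with rfl | hj
    · exact le_rfl
    · exact hj.1.le
  · rintro ⟨h, hs⟩
    refine ⟨(vectorMatroid_isBase_iff v B).2 ⟨?_, hs⟩, ?_⟩
    · by_contra hB
      have hdep : (vectorMatroid v).Dep B := ⟨hB, Set.subset_univ _⟩
      obtain ⟨C, hCB, hC⟩ := hdep.exists_isCircuit_subset
      obtain ⟨e, he, hle⟩ := (Set.toFinite C).exists_minimal hC.nonempty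
      refine hmin h C e hC ⟨he, fun j hj => ?_⟩ (Set.sdiff_subset.trans hCB)
      exact (le_total e j).elim id (hle hj)
    · rintro _ ⟨C, e, hC, he, rfl⟩
      exact hmin h C e hC he

end VectorMatroid

/-! ### Coordinate functions, duality and rank -/

variable {m : ℕ}

/-- The `i`-th coordinate function on a subspace of `ℝ^m`. -/
def coordFun (L : Submodule ℝ (Fin m → ℝ)) (i : Fin m) : Module.Dual ℝ L :=
  (LinearMap.proj i : (Fin m → ℝ) →ₗ[ℝ] ℝ) ∘ₗ L.subtype

theorem coordFun_apply (L : Submodule ℝ (Fin m → ℝ)) (i : Fin m) (x : L) :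
    coordFun L i x = (x : Fin m → ℝ) i := rfl

/-- A functional is a combination of finitely many others exactly when it vanishes on their common
kernel. -/
theorem mem_span_coordFun_iff (L : Submodule ℝ (Fin m → ℝ)) (S : Set (Fin m))
    (f : Module.Dual ℝ L) :
    f ∈ Submodule.span ℝ (coordFun L '' S) ↔
      ∀ x : L, (∀ i ∈ S, (x : Fin m → ℝ) i = 0) → f x = 0 := by
  constructor
  · intro hf x hx
    induction hf using Submodule.span_induction with
    | mem g hg => obtain ⟨i, hi, rfl⟩ := hg; exact hx i hi
    | zero => rfl
    | add g h _ _ hg hh => rw [LinearMap.add_apply, hg, hh, add_zero]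
    | smul a g _ hg => rw [LinearMap.smul_apply, hg, smul_zero]
  · intro h
    rw [Set.image_eq_range]
    refine mem_span_of_iInf_ker_le_ker fun x hx => h x fun i hi => ?_
    rw [Submodule.mem_iInf] at hx
    exact hx ⟨i, hi⟩

/-- The vectors of `L^⊥` supported on `I` are exactly the linear relations among the coordinate
functions on `L` indexed by `I`. Both conditions say that only zero is such a vector. -/
theorem perpMatroid_dual (L : Submodule ℝ (Fin m → ℝ)) :
    (perpMatroid L)✶ = vectorMatroid (coordFun L) := by
  refine Matroid.ext_indep rfl fun I _ => ?_
  have hp : perpMatroid L = vectorMatroid (coordFun (perp L)) := rfl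
  rw [hp, ← Matroid.Coindep, Matroid.coindep_iff_compl_spanning (Set.subset_univ _),
    vectorMatroid_ground, vectorMatroid_spanning_iff, vectorMatroid_indep, linearIndepOn_iff]
  simp only [mem_span_coordFun_iff, coordFun_apply]
  have hcomb : ∀ l : Fin m →₀ ℝ, Finsupp.linearCombination ℝ (coordFun L) l = 0 ↔
      (l : Fin m → ℝ) ∈ perp L := by
    intro l
    rw [Finsupp.linearCombination_apply, Finsupp.sum_fintype _ _ (by simp), LinearMap.ext_iff]
    simp only [LinearMap.sum_apply, LinearMap.smul_apply, coordFun_apply, smul_eq_mul,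
      LinearMap.zero_apply, Subtype.forall]
    refine forall₂_congr fun v _ => ?_
    rw [dotProduct, Finset.sum_congr rfl fun i _ => mul_comm _ _]
  constructor
  · intro h l hl h0
    ext i
    refine h i ⟨l, (hcomb l).1 h0⟩ fun j hj => ?_
    by_contra hne
    exact hj.2 ((Finsupp.mem_supported ℝ l).1 hl (Finsupp.mem_support_iff.2 hne))
  · intro h i x hx
    have := h (Finsupp.equivFunOnFinite.symm x) ?_ ((hcomb _).2 (by simp))
    · simpa using DFunLike.congr_fun this i
    · rw [Finsupp.mem_supported]
      intro j hj
      by_contra hjI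
      exact (Finsupp.mem_support_iff.1 hj) (hx j ⟨trivial, hjI⟩)

theorem perp_eq_comap (L : Submodule ℝ (Fin m → ℝ)) :
    perp L = L.dualAnnihilator.comap (dotProductEquiv ℝ (Fin m)).toLinearMap := by
  ext x
  simp only [Submodule.mem_comap, Submodule.mem_dualAnnihilator]
  refine forall₂_congr fun v _ => ?_
  simp [dotProduct_comm]

theorem finrank_perp (L : Submodule ℝ (Fin m → ℝ)) :
    Module.finrank ℝ (perp L) = m - Module.finrank ℝ L := by
  have h1 := Subspace.finrank_add_finrank_dualAnnihilator_eq L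
  have h2 : Module.finrank ℝ (perp L) = Module.finrank ℝ L.dualAnnihilator := by
    rw [perp_eq_comap]
    exact (Submodule.comap_equiv_self_of_inj_of_le (dotProductEquiv ℝ (Fin m)).injective
      (by simp)).finrank_eq
  rw [Module.finrank_fin_fun] at h1
  omega

/-- Coordinate functions separate the points of `L^⊥`, so a base is a basis of its dual space. -/
theorem perpMatroid_eRank (L : Submodule ℝ (Fin m → ℝ)) :
    (perpMatroid L).eRank = ((m - Module.finrank ℝ L : ℕ) : ℕ∞) := by
  obtain ⟨B, hB⟩ := (perpMatroid L).exists_isBase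
  rw [← hB.encard_eq_eRank, ← finrank_perp]
  obtain ⟨hi, hs⟩ := (vectorMatroid_isBase_iff (coordFun (perp L)) B).1 hB
  have htop : Submodule.span ℝ (coordFun (perp L) '' B) = ⊤ := by
    refine eq_top_iff.2 fun f _ => ?_
    rw [mem_span_coordFun_iff]
    intro x hx
    have : x = 0 := by
      ext i
      exact (mem_span_coordFun_iff _ _ _).1 (hs i) x hx
    rw [this, map_zero]
  have := Fintype.ofFinite B
  have h1 := finrank_span_eq_card (R := ℝ) (b := fun i : B => coordFun (perp L) i) hi
  rw [← Set.image_eq_range, htop, finrank_top, Subspace.dual_finrank_eq] at h1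
  rw [h1, ← Nat.card_eq_fintype_card, Nat.card_coe_set_eq, (Set.toFinite B).cast_ncard_eq]

theorem mem_of_forall_perp {L : Submodule ℝ (Fin m → ℝ)} {k : Fin m → ℝ}
    (h : ∀ z ∈ perp L, z ⬝ᵥ k = 0) : k ∈ L := by
  by_contra hk
  obtain ⟨f, hf, hf0⟩ := L.exists_dual_map_eq_bot_of_notMem hk inferInstance
  obtain ⟨z, rfl⟩ := (dotProductEquiv ℝ (Fin m)).surjective f
  refine hf (h z ?_)
  rw [perp_eq_comap, Submodule.mem_comap, Submodule.mem_dualAnnihilator]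
  intro w hw
  have : dotProductEquiv ℝ (Fin m) z w ∈ L.map (dotProductEquiv ℝ (Fin m) z) := ⟨w, hw, rfl⟩
  rw [hf0] at this
  exact this

/-! ### Critical points on polytopes -/

/-- By compactness the combination map has norm at least some `c > 0` on the standard simplex;
homogeneity then bounds `∑ xᵢ` by the norm of `u` over `c`. -/
theorem isCompact_nonneg_combinations {n : ℕ} {V : Type*} [AddCommGroup V] [Module ℝ V]
    [FiniteDimensional ℝ V] (w : Fin n → V) (u : V)
    (hw : ∀ y : Fin n → ℝ, (∀ i, 0 ≤ y i) → ∑ i, y i • w i = 0 → y = 0) :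
    IsCompact {x : Fin n → ℝ | (∀ i, 0 ≤ x i) ∧ ∑ i, x i • w i = u} := by
  let E := (Module.finBasis ℝ V).equivFun
  let Φ : (Fin n → ℝ) →ₗ[ℝ] (Fin (Module.finrank ℝ V) → ℝ) :=
    E.toLinearMap ∘ₗ Fintype.linearCombination ℝ w
  have hΦ : ∀ x z, ∑ i, x i • w i = z ↔ Φ x = E z := fun x z => by
    rw [← Fintype.linearCombination_apply ℝ w x]
    exact E.injective.eq_iff.symm
  have hcont : Continuous Φ := LinearMap.continuous_of_finiteDimensional Φ
  have hset : {x : Fin n → ℝ | (∀ i, 0 ≤ x i) ∧ ∑ i, x i • w i = u} =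
      Set.Ici 0 ∩ Φ ⁻¹' {E u} := by
    ext x
    simp [hΦ, Pi.le_def]
  rw [hset]
  refine Metric.isCompact_of_isClosed_isBounded
    (isClosed_Ici.inter (isClosed_singleton.preimage hcont)) ?_
  have hΔ : IsCompact (stdSimplex ℝ (Fin n)) := isCompact_stdSimplex ℝ _
  obtain ⟨c, hc, hcb⟩ : ∃ c > 0, ∀ y ∈ stdSimplex ℝ (Fin n), c ≤ ‖Φ y‖ := by
    rcases (stdSimplex ℝ (Fin n)).eq_empty_or_nonempty with he | hne
    · exact ⟨1, one_pos, by simp [he]⟩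
    · obtain ⟨y, hy, hmin⟩ := hΔ.exists_isMinOn hne hcont.norm.continuousOn
      refine ⟨‖Φ y‖, norm_pos_iff.2 fun h0 => ?_, hmin⟩
      have := hw y hy.1 ((hΦ y 0).2 (by simpa using h0))
      have h1 := hy.2
      simp [this] at h1
  refine (Metric.isBounded_Icc (0 : Fin n → ℝ) (fun _ => ‖E u‖ / c)).subset ?_
  rintro x ⟨hx, hxu⟩
  refine ⟨hx, fun i => ?_⟩
  have hxi : ∀ i, 0 ≤ x i := hx
  have hsum : x i ≤ ∑ j, x j := Finset.single_le_sum (fun j _ => hxi j) (Finset.mem_univ i)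
  rcases (Finset.sum_nonneg fun j (_ : j ∈ Finset.univ) => hxi j).eq_or_lt with h0 | h0
  · exact (hsum.trans h0.symm.le).trans (by positivity)
  · have hmem : (∑ j, x j)⁻¹ • x ∈ stdSimplex ℝ (Fin n) := by
      refine ⟨fun j => mul_nonneg (inv_nonneg.2 h0.le) (hxi j), ?_⟩
      simp only [Pi.smul_apply, smul_eq_mul]
      rw [← Finset.mul_sum, inv_mul_cancel₀ h0.ne']
    have h2 := hcb _ hmem
    rw [map_smul, show Φ x = E u from hxu, norm_smul, norm_inv, Real.norm_of_nonneg h0.le,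
      inv_mul_eq_div, le_div_iff₀ h0] at h2
    refine hsum.trans ((le_div_iff₀ hc).2 (by linarith))

/-- The support of `x` has `u` in its span, hence by `hu` spans every `w i`. The sum of the vectors
off the support is thus a combination `l` on it, and a small step along this relation makes all
coordinates positive. -/
theorem exists_pos_combination {n : ℕ} {V : Type*} [AddCommGroup V] [Module ℝ V]
    (w : Fin n → V) (u : V)
    (hu : ∀ S : Set (Fin n), u ∈ Submodule.span ℝ (w '' S) →
      ∀ i, w i ∈ Submodule.span ℝ (w '' S))
    (x : Fin n → ℝ) (hx : ∀ i, 0 ≤ x i) (hxu : ∑ i, x i • w i = u) :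
    ∃ z : Fin n → ℝ, (∀ i, 0 < z i) ∧ ∑ i, z i • w i = u := by
  classical
  set S : Set (Fin n) := {i | x i ≠ 0} with hS
  have huS : u ∈ Submodule.span ℝ (w '' S) := by
    rw [← hxu]
    refine Submodule.sum_mem _ fun i _ => ?_
    by_cases hi : x i = 0
    · simp [hi]
    · exact Submodule.smul_mem _ _ (Submodule.subset_span ⟨i, hi, rfl⟩)
  have hmem : ∑ i, (if x i = 0 then (1 : ℝ) else 0) • w i ∈ Submodule.span ℝ (w '' S) :=
    Submodule.sum_mem _ fun i _ => Submodule.smul_mem _ _ (hu S huS i)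
  rw [Finsupp.mem_span_image_iff_linearCombination] at hmem
  obtain ⟨l, hl, hlw⟩ := hmem
  rw [Finsupp.linearCombination_apply, Finsupp.sum_fintype _ _ (by simp)] at hlw
  have hl0 : ∀ i, x i = 0 → l i = 0 := by
    intro i hi
    by_contra h
    exact ((Finsupp.mem_supported ℝ l).1 hl (Finsupp.mem_support_iff.2 h)) hi
  have hev : ∀ᶠ t in nhdsWithin (0 : ℝ) (Set.Ioi 0), ∀ i,
      0 < x i + t * ((if x i = 0 then (1 : ℝ) else 0) - l i) := by
    rw [Filter.eventually_all]
    intro i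
    rcases (hx i).eq_or_lt with h | h
    · filter_upwards [self_mem_nhdsWithin] with t ht
      rw [← h, hl0 i h.symm]
      simpa using ht
    · refine Filter.Eventually.filter_mono nhdsWithin_le_nhds ?_
      have hc : ContinuousAt (fun t : ℝ => x i + t * ((if x i = 0 then (1 : ℝ) else 0) - l i)) 0 := by
        fun_prop
      exact hc.eventually (lt_mem_nhds (by simpa using h))
  obtain ⟨t, ht⟩ := hev.exists
  refine ⟨_, ht, ?_⟩
  have := comb_nonneg w (x := x) (y := fun i => (if x i = 0 then (1 : ℝ) else 0) - l i) 1 t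
  simp only [one_mul] at this
  rw [this, hxu]
  simp only [sub_smul, Finset.sum_sub_distrib]
  rw [← hlw]
  simp

/-- On a compact polytope `{x ≥ 0, ∑ xᵢ wᵢ = u}` with a strictly positive point, the product of the
coordinates has a strictly positive critical point. -/
theorem exists_critical_point {n : ℕ} {V : Type*} [AddCommGroup V] [Module ℝ V]
    [FiniteDimensional ℝ V] (w : Fin n → V) (u : V)
    (hw : ∀ y : Fin n → ℝ, (∀ i, 0 ≤ y i) → ∑ i, y i • w i = 0 → y = 0)
    (z : Fin n → ℝ) (hz : ∀ i, 0 < z i) (hzu : ∑ i, z i • w i = u) :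
    ∃ x : Fin n → ℝ, (∀ i, 0 < x i) ∧ ∑ i, x i • w i = u ∧
      ∀ b : Fin n → ℝ, ∑ i, b i • w i = 0 → ∑ i, b i / x i = 0 := by
  obtain ⟨x, ⟨hx, hxu⟩, hmax⟩ := (isCompact_nonneg_combinations w u hw).exists_isMaxOn
    ⟨z, fun i => (hz i).le, hzu⟩ (f := fun x => ∏ i, x i) (by fun_prop)
  have hprod : 0 < ∏ i, x i :=
    (Finset.prod_pos fun i _ => hz i).trans_le (hmax ⟨fun i => (hz i).le, hzu⟩)
  have hpos : ∀ i, 0 < x i := fun i => (hx i).lt_of_ne'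
    (Finset.prod_ne_zero_iff.1 hprod.ne' i (Finset.mem_univ i))
  refine ⟨x, hpos, hxu, fun b hb => ?_⟩
  -- Since `b` is a relation, `x + t b` stays in the polytope for small `t`, so the log of the
  -- product has a local maximum at `t = 0`.
  have hder : HasDerivAt (fun t : ℝ => ∑ i, Real.log (x i + t * b i)) (∑ i, b i / x i) 0 := by
    refine HasDerivAt.fun_sum fun i _ => ?_
    have h1 : HasDerivAt (fun t : ℝ => x i + t * b i) (b i) 0 := by
      simpa using ((hasDerivAt_id (0 : ℝ)).mul_const (b i)).const_add (x i)
    simpa using h1.log (by simpa using (hpos i).ne')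
  refine IsLocalMax.hasDerivAt_eq_zero ?_ hder
  have hev : ∀ᶠ t in nhds (0 : ℝ), ∀ i, 0 < x i + t * b i := by
    rw [Filter.eventually_all]
    intro i
    have hc : ContinuousAt (fun t : ℝ => x i + t * b i) 0 := by fun_prop
    exact hc.eventually (lt_mem_nhds (by simpa using hpos i))
  filter_upwards [hev] with t ht
  rw [← Real.log_prod fun i _ => (ht i).ne', ← Real.log_prod fun i _ => by simpa using (hpos i).ne']
  refine Real.log_le_log (Finset.prod_pos fun i _ => ht i) ?_
  have := comb_nonneg w (x := x) (y := b) 1 t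
  simp only [one_mul] at this
  simpa using hmax (show (fun i => x i + t * b i) ∈ _ from
    ⟨fun i => (ht i).le, by rw [this, hb, hxu]; simp⟩)

/-! ### Generic data -/

/-- The functional `∑ sᵢ xᵢ` on a subspace of `ℝ^m`. -/
def dataFun (L : Submodule ℝ (Fin m → ℝ)) (s : Fin m → ℝ) : Module.Dual ℝ L :=
  ∑ i, s i • coordFun L i

theorem dataFun_apply (L : Submodule ℝ (Fin m → ℝ)) (s : Fin m → ℝ) (x : L) :
    dataFun L s x = ∑ i, s i * (x : Fin m → ℝ) i := by
  simp [dataFun, coordFun_apply]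

theorem sum_smul_coordFun_eq_iff (L : Submodule ℝ (Fin m → ℝ)) (x s : Fin m → ℝ) :
    ∑ i, x i • coordFun L i = dataFun L s ↔ ∀ v ∈ L, ∑ i, (x i - s i) * v i = 0 := by
  rw [LinearMap.ext_iff, Subtype.forall]
  refine forall₂_congr fun v hv => ?_
  rw [show ∑ i, x i • coordFun L i = dataFun L x from rfl, dataFun_apply, dataFun_apply]
  simp only [sub_mul, Finset.sum_sub_distrib]
  exact sub_eq_zero.symm

/-- The functional of `s` is not in the span of any set of coordinate functions that fails to span
all of them. -/
def IsGenericData (L : Submodule ℝ (Fin m → ℝ)) (s : Fin m → ℝ) : Prop :=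
  ∀ S : Set (Fin m), dataFun L s ∈ Submodule.span ℝ (coordFun L '' S) →
    ∀ i, coordFun L i ∈ Submodule.span ℝ (coordFun L '' S)

/-- For each nonspanning `S` some nonzero `x` in `L` vanishes on `S`, and `∑ xⱼ sⱼ` must vanish for
bad `s`. The product of these linear forms over all such `S` works. -/
theorem exists_polynomial_isGenericData (L : Submodule ℝ (Fin m → ℝ)) :
    ∃ f : MvPolynomial (Fin m) ℝ, f ≠ 0 ∧
      ∀ s : Fin m → ℝ, MvPolynomial.eval s f ≠ 0 → IsGenericData L s := by
  classical
  have key : ∀ S : Set (Fin m), ∃ q : MvPolynomial (Fin m) ℝ, q ≠ 0 ∧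
      ∀ s : Fin m → ℝ, MvPolynomial.eval s q ≠ 0 →
        dataFun L s ∈ Submodule.span ℝ (coordFun L '' S) →
        ∀ i, coordFun L i ∈ Submodule.span ℝ (coordFun L '' S) := by
    intro S
    by_cases hS : ∀ i, coordFun L i ∈ Submodule.span ℝ (coordFun L '' S)
    · exact ⟨1, one_ne_zero, fun _ _ _ => hS⟩
    · push Not at hS
      obtain ⟨i, hi⟩ := hS
      rw [mem_span_coordFun_iff] at hi
      push Not at hi
      obtain ⟨x, hxS, hxi⟩ := hi
      have hev : ∀ s : Fin m → ℝ, MvPolynomial.eval s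
          (∑ j, MvPolynomial.C ((x : Fin m → ℝ) j) * MvPolynomial.X j) = dataFun L s x := by
        intro s
        simp [dataFun_apply, mul_comm]
      refine ⟨∑ j, MvPolynomial.C ((x : Fin m → ℝ) j) * MvPolynomial.X j, fun h0 => ?_, ?_⟩
      -- At `s = x` the form equals `∑ xⱼ²`.
      · have := hev x
        rw [h0, map_zero, dataFun_apply, eq_comm,
          Finset.sum_eq_zero_iff_of_nonneg fun j _ => mul_self_nonneg _] at this
        exact hxi (mul_self_eq_zero.1 (this i (Finset.mem_univ i)))
      · intro s hs hmem
        rw [hev] at hs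
        exact absurd ((mem_span_coordFun_iff _ _ _).1 hmem x hxS) hs
  choose q hq hqs using key
  refine ⟨∏ S, q S, Finset.prod_ne_zero_iff.2 fun S _ => hq S, fun s hs S => ?_⟩
  rw [map_prod, Finset.prod_ne_zero_iff] at hs
  exact hqs S s (hs S (Finset.mem_univ S))

/-! ### Real solutions and their signs -/

/-- The reciprocals in `L` of the points of `s + L^⊥`. -/
def realSolutions (L : Submodule ℝ (Fin m → ℝ)) (s : Fin m → ℝ) : Set (Fin m → ℝ) :=
  {k | k ∈ L ∧ (∀ i, k i ≠ 0) ∧ ∀ v ∈ L, ∑ i, ((k i)⁻¹ - s i) * v i = 0}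

theorem boolSign_mul_self (b : Bool) : boolSign b * boolSign b = 1 := by
  cases b <;> simp [boolSign]

theorem boolSign_ne_zero (b : Bool) : boolSign b ≠ 0 := by
  cases b <;> simp [boolSign]

theorem boolSign_decide_mul (a : ℝ) : boolSign (decide (0 < a)) * a = |a| := by
  by_cases h : 0 < a
  · simp [boolSign, h, abs_of_pos]
  · simp [boolSign, h, abs_of_nonpos (not_lt.1 h)]

theorem span_boolSign_smul_image {V : Type*} [AddCommGroup V] [Module ℝ V] (e : Fin m → Bool)
    (v : Fin m → V) (S : Set (Fin m)) :
    Submodule.span ℝ ((fun i => boolSign (e i) • v i) '' S) = Submodule.span ℝ (v '' S) := by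
  refine le_antisymm (Submodule.span_le.2 ?_) (Submodule.span_le.2 ?_)
  · rintro _ ⟨i, hi, rfl⟩
    exact Submodule.smul_mem _ _ (Submodule.subset_span ⟨i, hi, rfl⟩)
  · rintro _ ⟨i, hi, rfl⟩
    have : v i = boolSign (e i) • (boolSign (e i) • v i) := by
      rw [smul_smul, boolSign_mul_self, one_smul]
    rw [this]
    exact Submodule.smul_mem _ _ (Submodule.subset_span ⟨i, hi, rfl⟩)

/-- Taking signs is a bijection from the solutions to the sign vectors whose cone of coordinate
functions is pointed and contains the functional of `s`. -/
theorem bijOn_realSolutions (L : Submodule ℝ (Fin m → ℝ)) {s : Fin m → ℝ}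
    (hs : IsGenericData L s) :
    Set.BijOn (fun k i => decide (0 < k i)) (realSolutions L s)
      {e : Fin m → Bool | InPointedCone (fun i => boolSign (e i) • coordFun L i)
        (dataFun L s)} := by
  have hcone : ∀ (e : Fin m → Bool) (x : Fin m → ℝ),
      ∑ i, x i • boolSign (e i) • coordFun L i = dataFun L (fun i => x i * boolSign (e i)) := by
    intro e x
    simp only [dataFun, smul_smul]
  refine ⟨?_, ?_, ?_⟩
  · rintro k ⟨hkL, hk, hkv⟩
    refine ⟨⟨fun i => |k i|⁻¹, fun i => by positivity, ?_⟩, fun y hy h0 => ?_⟩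
    · rw [hcone, dataFun, sum_smul_coordFun_eq_iff]
      convert hkv using 8 with v hv i
      rw [← boolSign_decide_mul, mul_inv, mul_right_comm,
        inv_mul_cancel₀ (boolSign_ne_zero _), one_mul]
    · rw [hcone] at h0
      -- Evaluated at `k` itself, the relation becomes `∑ yᵢ |kᵢ| = 0`.
      have h1 := LinearMap.congr_fun h0 ⟨k, hkL⟩
      rw [dataFun_apply, LinearMap.zero_apply] at h1
      simp only [mul_assoc, boolSign_decide_mul] at h1
      rw [Finset.sum_eq_zero_iff_of_nonneg fun i _ => mul_nonneg (hy i) (abs_nonneg _)] at h1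
      funext i
      exact (mul_eq_zero.1 (h1 i (Finset.mem_univ i))).resolve_right (abs_ne_zero.2 (hk i))
  · rintro k ⟨hkL, hk, hkv⟩ l ⟨hlL, hl, hlv⟩ hkl
    have hpos : ∀ i, 0 < k i * l i := by
      intro i
      have h1 : (0 < k i ↔ 0 < l i) := by simpa using congrFun hkl i
      rcases (hk i).lt_or_gt with h | h
      · exact mul_pos_of_neg_of_neg h ((hl i).lt_of_le (not_lt.1 fun h' => h.not_gt (h1.2 h')))
      · exact mul_pos h (h1.1 h)
    have h1 := hkv (k - l) (sub_mem hkL hlL)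
    have h2 := hlv (k - l) (sub_mem hkL hlL)
    -- The two equations tested against `k - l` and subtracted; equal signs make every term
    -- nonnegative.
    have h3 : ∑ i, (k i - l i) ^ 2 / (k i * l i) = 0 := by
      rw [← sub_eq_zero.2 (h2.trans h1.symm), ← Finset.sum_sub_distrib]
      refine Finset.sum_congr rfl fun i _ => ?_
      have := hk i
      have := hl i
      simp only [Pi.sub_apply]
      field_simp
      ring
    rw [Finset.sum_eq_zero_iff_of_nonneg fun i _ => div_nonneg (sq_nonneg _) (hpos i).le] at h3
    funext i
    have := (div_eq_zero_iff.1 (h3 i (Finset.mem_univ i))).resolve_right (hpos i).ne'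
    exact sub_eq_zero.1 (pow_eq_zero_iff two_ne_zero |>.1 this)
  · rintro e ⟨⟨x₀, hx₀, hx₀u⟩, hacyc⟩
    obtain ⟨z, hz, hzu⟩ := exists_pos_combination _ (dataFun L s)
      (fun S hS i => by
        rw [span_boolSign_smul_image] at hS ⊢
        exact Submodule.smul_mem _ _ (hs S hS i)) x₀ hx₀ hx₀u
    obtain ⟨x, hx, hxu, hcrit⟩ := exists_critical_point _ (dataFun L s) hacyc z hz hzu
    refine ⟨fun i => boolSign (e i) / x i, ⟨?_, fun i => ?_, ?_⟩, ?_⟩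
    · refine mem_of_forall_perp fun y hy => ?_
      -- Criticality in the direction `y e`, for `y` in `L^⊥`, says that `e / x` is orthogonal to
      -- `y`.
      have h1 := hcrit (fun i => y i * boolSign (e i)) (by
        rw [hcone]
        ext ⟨v, hv⟩
        rw [dataFun_apply, LinearMap.zero_apply, ← hy v hv, dotProduct]
        refine Finset.sum_congr rfl fun i _ => ?_
        rw [mul_assoc (y i), boolSign_mul_self, mul_one, mul_comm])
      rw [← h1, dotProduct]
      exact Finset.sum_congr rfl fun i _ => (mul_div_assoc _ _ _).symm
    · exact div_ne_zero (boolSign_ne_zero _) (hx i).ne'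
    · rw [hcone, dataFun, sum_smul_coordFun_eq_iff] at hxu
      convert hxu using 8 with v hv i
      rw [inv_div, div_eq_iff (boolSign_ne_zero _), mul_assoc, boolSign_mul_self, mul_one]
    · funext i
      have := hx i
      cases h : e i
      · simpa [boolSign, h] using div_nonpos_of_nonpos_of_nonneg (by norm_num) this.le
      · simp [boolSign, h, this]

theorem encard_realSolutions (L : Submodule ℝ (Fin m → ℝ)) {s : Fin m → ℝ}
    (hs : IsGenericData L s) : (realSolutions L s).encard = beta L := by
  classical
  have hbij := bijOn_realSolutions L hs
  rw [← hbij.injOn.encard_image, hbij.image_eq]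
  have hB : brokenCircuitBases (perpMatroid L)✶ = (fun b : Fin m → Bool => {j | b j = true}) ''
      {b | NoBrokenCircuit (coordFun L) b ∧
        dataFun L s ∈ Submodule.span ℝ (coordFun L '' {j | b j = true})} := by
    have hspan : ∀ B : Set (Fin m), (∀ i, coordFun L i ∈ Submodule.span ℝ (coordFun L '' B)) ↔
        dataFun L s ∈ Submodule.span ℝ (coordFun L '' B) := fun B =>
      ⟨fun h => Submodule.sum_mem _ fun i _ => Submodule.smul_mem _ _ (h i), hs B⟩
    ext B
    rw [perpMatroid_dual, mem_brokenCircuitBases_vectorMatroid, hspan]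
    constructor
    · intro h
      exact ⟨fun j => decide (j ∈ B), by simpa [NoBrokenCircuit] using h, by simp⟩
    · rintro ⟨b, hb, rfl⟩
      exact hb
  have hinj : Function.Injective (fun b : Fin m → Bool => {j | b j = true}) := by
    intro b c h
    funext j
    have : (b j = true ↔ c j = true) := Set.ext_iff.1 h j
    exact Bool.eq_iff_iff.2 this
  rw [beta, hB, Set.ncard_image_of_injective _ hinj, ← (Set.toFinite _).cast_ncard_eq]
  have h := sum_inPointedCone_eq_sum_noBrokenCircuit (coordFun L) (dataFun L s)
  rw [← Finset.card_filter, ← Finset.card_filter] at h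
  rw [Set.ncard_eq_toFinset_card', Set.ncard_eq_toFinset_card', Set.toFinset_ofPred,
    Set.toFinset_ofPred, h]

/-! ### Reduction of complex solutions to real ones -/

theorem re_im_mem_of_mem_complexify {n : Type*} {L : Submodule ℝ (Matrix n n ℝ)}
    {K : Matrix n n ℂ} (hK : K ∈ complexify L) : K.map Complex.re ∈ L ∧ K.map Complex.im ∈ L := by
  induction hK using Submodule.span_induction with
  | mem x hx =>
    obtain ⟨A, hA, rfl⟩ := hx
    constructor
    · rw [show ((fun A : Matrix n n ℝ => A.map Complex.ofReal) A).map Complex.re = A by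
        ext i j; simp]
      exact hA
    · convert L.zero_mem
      ext i j
      simp
  | zero =>
    constructor <;>
    · convert L.zero_mem
      ext i j
      simp
  | add x y _ _ hx hy =>
    constructor
    · convert L.add_mem hx.1 hy.1
      ext i j
      simp
    · convert L.add_mem hx.2 hy.2
      ext i j
      simp
  | smul a x _ hx =>
    constructor
    · convert L.sub_mem (L.smul_mem a.re hx.1) (L.smul_mem a.im hx.2)
      ext i j
      simp
    · convert L.add_mem (L.smul_mem a.re hx.2) (L.smul_mem a.im hx.1)
      ext i j
      simp

theorem trace_mul_map_diagonal (A : Matrix (Fin m) (Fin m) ℂ) (v : Fin m → ℝ) :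
    (A * (Matrix.diagonal v).map Complex.ofReal).trace = ∑ i, A i i * (v i : ℂ) := by
  rw [Matrix.diagonal_map Complex.ofReal_zero, Matrix.trace]
  simp [Matrix.mul_diagonal]

/-- All complex solutions of the likelihood equations of a diagonal model are real. -/
theorem likelihoodSolutions_diagonal (L : Submodule ℝ (Fin m → ℝ)) (S : Matrix (Fin m) (Fin m) ℝ) :
    likelihoodSolutions (L.map (Matrix.diagonalLinearMap (Fin m) ℝ ℝ)) S =
      (fun k : Fin m → ℝ => Matrix.diagonal fun i => ((k i : ℂ))⁻¹) ''
        realSolutions L (fun i => S i i) := by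
  ext Sig
  constructor
  · rintro ⟨-, ⟨K, hK, hSK⟩, htr⟩
    obtain ⟨⟨p, hp, hpK⟩, ⟨q, hq, hqK⟩⟩ := re_im_mem_of_mem_complexify hK
    have hKd : K = Matrix.diagonal fun i => (⟨p i, q i⟩ : ℂ) := by
      ext i j
      have h1 : (Matrix.diagonal p : Matrix (Fin m) (Fin m) ℝ) i j = (K i j).re :=
        congrFun (congrFun hpK i) j
      have h2 : (Matrix.diagonal q : Matrix (Fin m) (Fin m) ℝ) i j = (K i j).im :=
        congrFun (congrFun hqK i) j
      by_cases hij : i = j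
      · subst hij
        rw [Matrix.diagonal_apply_eq] at h1 h2 ⊢
        exact Complex.ext h1.symm h2.symm
      · rw [Matrix.diagonal_apply_ne _ hij] at h1 h2 ⊢
        exact Complex.ext h1.symm h2.symm
    subst hKd
    have hk0 : ∀ i, (⟨p i, q i⟩ : ℂ) ≠ 0 := by
      intro i h0
      have := congrFun (congrFun hSK i) i
      rw [Matrix.mul_diagonal, h0, mul_zero, Matrix.one_apply_eq] at this
      exact zero_ne_one this
    have hSig : Sig = Matrix.diagonal fun i => (⟨p i, q i⟩ : ℂ)⁻¹ := by
      ext i j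
      have := congrFun (congrFun hSK i) j
      rw [Matrix.mul_diagonal, Matrix.one_apply] at this
      rw [(eq_mul_inv_iff_mul_eq₀ (hk0 j)).2 this, Matrix.diagonal_apply]
      split_ifs with hij
      · rw [hij, one_mul]
      · rw [zero_mul]
    have hv : ∀ v ∈ L, ∑ i, ((⟨p i, q i⟩ : ℂ)⁻¹ - (S i i : ℂ)) * (v i : ℂ) = 0 := by
      intro v hv
      have := htr (Matrix.diagonal v) ⟨v, hv, rfl⟩
      rw [trace_mul_map_diagonal, hSig] at this
      simpa using this
    have hq0 : q = 0 := by
      -- The imaginary part of `(p + iq)⁻¹ q` is `-q²/|p + iq|²`, and the real data contribute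
      -- nothing.
      have h1 := congrArg Complex.im (hv q hq)
      have h2 : ∑ i, q i ^ 2 / Complex.normSq ⟨p i, q i⟩ = 0 := by
        rw [Complex.im_sum] at h1
        rw [← neg_eq_zero, ← Finset.sum_neg_distrib, ← Complex.zero_im, ← h1]
        refine Finset.sum_congr rfl fun i _ => ?_
        simp [Complex.mul_im, Complex.inv_im]
        ring
      rw [Finset.sum_eq_zero_iff_of_nonneg
        fun i _ => div_nonneg (sq_nonneg _) (Complex.normSq_nonneg _)] at h2
      funext i
      have := (div_eq_zero_iff.1 (h2 i (Finset.mem_univ i))).resolve_right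
        (fun h => hk0 i (Complex.normSq_eq_zero.1 h))
      exact pow_eq_zero_iff two_ne_zero |>.1 this
    have hpq : ∀ i, (⟨p i, q i⟩ : ℂ) = (p i : ℂ) := fun i => by rw [hq0]; rfl
    simp only [hpq] at hk0 hSig hv
    refine ⟨p, ⟨hp, fun i h => hk0 i (by rw [h, Complex.ofReal_zero]), fun v hvL => ?_⟩, hSig.symm⟩
    have := hv v hvL
    exact_mod_cast this
  · rintro ⟨k, ⟨hkL, hk, hkv⟩, rfl⟩
    refine ⟨Matrix.isSymm_diagonal _, ⟨(Matrix.diagonal k).map Complex.ofReal,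
      Submodule.subset_span ⟨_, ⟨k, hkL, rfl⟩, rfl⟩, ?_⟩, ?_⟩
    · rw [Matrix.diagonal_map Complex.ofReal_zero, Matrix.diagonal_mul_diagonal,
        ← Matrix.diagonal_one]
      congr 1
      funext i
      exact inv_mul_cancel₀ (Complex.ofReal_ne_zero.2 (hk i))
    · rintro _ ⟨v, hv, rfl⟩
      refine (trace_mul_map_diagonal _ v).trans ?_
      simp only [Matrix.sub_apply, Matrix.diagonal_apply_eq, Matrix.map_apply]
      exact_mod_cast hkv v hv

end LinearConcentration

theorem corollary3p2 {m : ℕ} (L : Submodule ℝ (Fin m → ℝ)) (hL : ∃ v ∈ L, ∀ i, 0 < v i) :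
    (LinearConcentration.perpMatroid L).eRank = ((m - Module.finrank ℝ L : ℕ) : ℕ∞) ∧
    LinearConcentration.HasMLDegree (L.map (Matrix.diagonalLinearMap (Fin m) ℝ ℝ))
      (LinearConcentration.beta L) := by
  refine ⟨LinearConcentration.perpMatroid_eRank L, ?_⟩
  obtain ⟨f, hf, hfs⟩ := LinearConcentration.exists_polynomial_isGenericData L
  have hev : ∀ S : Matrix (Fin m) (Fin m) ℝ,
      MvPolynomial.eval (fun p : Fin m × Fin m => S p.1 p.2)
        (MvPolynomial.rename (fun i => (i, i)) f) = MvPolynomial.eval (fun i => S i i) f :=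
    fun S => MvPolynomial.eval_rename _ _ _
  -- Only the diagonal of `S` matters, so the genericity polynomial is read in the diagonal
  -- variables.
  refine ⟨MvPolynomial.rename (fun i => (i, i)) f, ?_, fun S _ hS => ?_⟩
  · obtain ⟨s, hs⟩ : ∃ s, MvPolynomial.eval s f ≠ 0 := by
      by_contra! h
      exact hf (MvPolynomial.funext fun s => by rw [h s, map_zero])
    refine ⟨Matrix.diagonal s, Matrix.isSymm_diagonal s, ?_⟩
    rw [hev]
    simpa using hs
  · rw [hev] at hS
    rw [LinearConcentration.likelihoodSolutions_diagonal, Function.Injective.encard_image,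
      LinearConcentration.encard_realSolutions L (hfs _ hS)]
    intro k l hkl
    funext i
    simpa using congrFun (Matrix.diagonal_injective hkl) i
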